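/- Let $(M,P,g)$ be a Riemannian almost product manifold: $M$ is a smooth (Hausdorff) manifold without boundary, $g$ is a smooth Riemannian metric and $P$ is a smooth tensor field of type $(1,1)$ with $P^2=\mathrm{id}$, $g(Px,Py)=g(x,y)$ and $\operatorname{tr}P=0$. Let $\nabla$ be the Levi-Civita connection of $g$, put $F(x,y,z)=g((\nabla_xP)y,z)$, and assume that $(M,P,g)$ is a Riemannian $\mathcal W_3$-manifold, i.e. $$F(x,y,z)+F(y,z,x)+F(z,x,y)=0$$ for all smooth vector fields $x,y,z$. Let $\nabla'$ be the canonical connection of $(M,P,g)$, i.e. the smooth linear connection with $\nabla'P=0$, $\nabla'g=0$ whose torsion $T(x,y)=\nabla'_xy-\nabla'_yx-[x,y]$, with $T(x,y,z)=g(T(x,y),z)$, satisfies $$T(x,y,z)+T(y,z,x)+T(Px,y,Pz)+T(y,Pz,Px)=0 .$$ Put $Q(x,y)=\nabla'_xy-\nabla_xy$. Let $R$ and $R'$ be the curvature tensors of $\nabla$ and $\nabla'$, where $R(x,y)z=\nabla_x\nabla_yz-\nabla_y\nabla_xz-\nabla_{[x,y]}z$, $R(x,y,z,w)=g(R(x,y)z,w)$,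 and similarly for $R'$. If the torsion of $\nabla'$ is parallel, $\nabla'T=0$, then for all smooth vector fields $x,y,z,w$ on $M$ $$\begin{aligned}R'(x,y,z,w)={}&R(x,y,z,w)+g(Q(y,z),Q(x,w))-g(Q(x,z),Q(y,w))\\&+g(Q(z,w),T(x,y))-g\big((\nabla_{Pw}P)z,\,T(x,y)\big).\end{aligned}$$ -/

import Mathlib

open Bundle
open scoped Manifold ContDiff

namespace AlmostProduct

noncomputable section

variable {m : ℕ} {M : Type*} [TopologicalSpace M] [ChartedSpace (EuclideanSpace ℝ (Fin m)) M]

/-- A (not necessarily smooth) vector field on `M`. -/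
abbrev VField (m : ℕ) (M : Type*) [TopologicalSpace M]
    [ChartedSpace (EuclideanSpace ℝ (Fin m)) M] : Type _ := Π p : M, TangentSpace (𝓡 m) p

/-- A tensor field of type (1,1) on `M`, i.e. a field of endomorphisms of the tangent spaces. -/
abbrev EndField (m : ℕ) (M : Type*) [TopologicalSpace M]
    [ChartedSpace (EuclideanSpace ℝ (Fin m)) M] : Type _ :=
  Π p : M, TangentSpace (𝓡 m) p →L[ℝ] TangentSpace (𝓡 m) p

section Smooth

variable [IsManifold (𝓡 m) ∞ M]

/-- The vector field `X` is smooth, i.e. a smooth section of the tangent bundle. -/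
def IsSmooth (X : VField m M) : Prop :=
  ContMDiff (𝓡 m) (𝓡 m).tangent ∞
    (fun p ↦ (⟨p, X p⟩ : TangentBundle (𝓡 m) M))

/-- The field of endomorphisms `P` is smooth, i.e. a smooth section of `End(TM)`. -/
def IsSmoothEnd (P : EndField m M) : Prop :=
  ContMDiff (𝓡 m)
    ((𝓡 m).prod 𝓘(ℝ, EuclideanSpace ℝ (Fin m) →L[ℝ] EuclideanSpace ℝ (Fin m))) ∞
    (fun p ↦ TotalSpace.mk' (EuclideanSpace ℝ (Fin m) →L[ℝ] EuclideanSpace ℝ (Fin m))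
      (E := fun p : M ↦ TangentSpace (𝓡 m) p →L[ℝ] TangentSpace (𝓡 m) p) p (P p))

end Smooth

/-- The vector field `P X`. -/
def EndField.app (P : EndField m M) (X : VField m M) : VField m M := fun p ↦ P p (X p)

/-- Linear connections on `M` (covariant derivatives on the tangent bundle). The value `∇_X Y` at
`p` is written `∇ Y p (X p)`. -/
abbrev Conn (m : ℕ) (M : Type*) [TopologicalSpace M]
    [ChartedSpace (EuclideanSpace ℝ (Fin m)) M] [IsManifold (𝓡 m) ∞ M] : Type _ :=
  CovariantDerivative (𝓡 m) (EuclideanSpace ℝ (Fin m)) (TangentSpace (𝓡 m) : M → Type _)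

section Connections

variable [IsManifold (𝓡 m) ∞ M]

/-- The vector field `∇_X Y`. -/
def Conn.der (D : Conn m M) (X Y : VField m M) : VField m M := fun p ↦ D Y p (X p)

/-- `(∇_X P) Y = ∇_X (P Y) - P (∇_X Y)`. -/
def Conn.derEnd (D : Conn m M) (P : EndField m M) (X Y : VField m M) : VField m M :=
  fun p ↦ D.der X (P.app Y) p - P p (D.der X Y p)

/-- The torsion as an operation on vector fields:
`T(X, Y) = ∇_X Y - ∇_Y X - [X, Y]` for differentiable vector fields. -/
def Conn.tor (D : Conn m M) (X Y : VField m M) : VField m M :=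
  fun p ↦ D.torsion p (X p) (Y p)

/-- `(∇_X T)(Y, Z) = ∇_X (T(Y, Z)) - T(∇_X Y, Z) - T(Y, ∇_X Z)`, where `T` is the torsion
of `∇` itself. -/
def Conn.derTor (D : Conn m M) (X Y Z : VField m M) : VField m M :=
  fun p ↦ D.der X (D.tor Y Z) p - D.tor (D.der X Y) Z p - D.tor Y (D.der X Z) p

/-- The torsion `T` of `∇` is parallel: `∇ T = 0`. -/
def Conn.HasParallelTorsion (D : Conn m M) : Prop :=
  ∀ X Y Z : VField m M, IsSmooth X → IsSmooth Y → IsSmooth Z → ∀ p, D.derTor X Y Z p = 0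

/-- The curvature operator `R(X, Y) Z = ∇_X ∇_Y Z - ∇_Y ∇_X Z - ∇_{[X, Y]} Z`. -/
def Conn.curv (D : Conn m M) (X Y Z : VField m M) : VField m M :=
  fun p ↦ D.der X (D.der Y Z) p - D.der Y (D.der X Z) p
    - D.der (VectorField.mlieBracket (𝓡 m) X Y) Z p

/-- The tensor `Q(X, Y) = ∇'_X Y - ∇_X Y` of the deformation `∇ → ∇'`. -/
def deformation (D D' : Conn m M) (X Y : VField m M) : VField m M :=
  fun p ↦ D'.der X Y p - D.der X Y p

end Connections

section Metric

variable [IsManifold (𝓡 m) ∞ M]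

/-- Smooth Riemannian metrics on `M`. -/
abbrev Metric (m : ℕ) (M : Type*) [TopologicalSpace M]
    [ChartedSpace (EuclideanSpace ℝ (Fin m)) M] [IsManifold (𝓡 m) ∞ M] : Type _ :=
  ContMDiffRiemannianMetric (𝓡 m) ∞ (EuclideanSpace ℝ (Fin m))
    (fun p : M ↦ TangentSpace (𝓡 m) p)

/-- The function `g(X, Y)`. -/
def Metric.app (g : Metric m M) (X Y : VField m M) (p : M) : ℝ := g.inner p (X p) (Y p)

/-- `(M, P, g)` is a Riemannian almost product manifold with `tr P = 0`. -/
structure IsAlmostProduct (g : Metric m M) (P : EndField m M) : Prop where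
  smooth : IsSmoothEnd P
  sq : ∀ (p : M) (x : TangentSpace (𝓡 m) p), P p (P p x) = x
  isometry : ∀ (p : M) (x y : TangentSpace (𝓡 m) p),
    g.inner p (P p x) (P p y) = g.inner p x y
  trace : ∀ p : M, LinearMap.trace ℝ (TangentSpace (𝓡 m) p) (P p).toLinearMap = 0

/-- `∇ g = 0`, i.e. `X (g(Y, Z)) = g(∇_X Y, Z) + g(Y, ∇_X Z)`. -/
def IsMetricConn (g : Metric m M) (D : Conn m M) : Prop :=
  ∀ X Y Z : VField m M, IsSmooth X → IsSmooth Y → IsSmooth Z → ∀ p,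
    mvfderiv (𝓡 m) (g.app Y Z) p (X p) = g.app (D.der X Y) Z p + g.app Y (D.der X Z) p

/-- `∇` is the Levi-Civita connection of `g`: the smooth, metric and torsion-free linear
connection. -/
structure IsLeviCivita (g : Metric m M) (D : Conn m M) : Prop where
  smooth : D.ContMDiffCovariantDerivative ∞
  metric : IsMetricConn g D
  torsion_free : D.torsion = 0

/-- The tensor `F(X, Y, Z) = g((∇_X P) Y, Z)` of type (0,3); here `∇` is meant to be the
Levi-Civita connection of `g`. -/
def F (g : Metric m M) (P : EndField m M) (D : Conn m M) (X Y Z : VField m M) (p : M) : ℝ :=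
  g.app (D.derEnd P X Y) Z p

/-- `(M, P, g)`, with Levi-Civita connection `∇`, is a Riemannian `W₃`-manifold: a Riemannian
almost product manifold with `tr P = 0` for which the cyclic sum of `F(X, Y, Z)` over `X, Y, Z`
vanishes. -/
structure IsW3 (g : Metric m M) (P : EndField m M) (D : Conn m M) : Prop where
  almostProduct : IsAlmostProduct g P
  leviCivita : IsLeviCivita g D
  cyclic : ∀ X Y Z : VField m M, IsSmooth X → IsSmooth Y → IsSmooth Z →
    ∀ p, F g P D X Y Z p + F g P D Y Z X p + F g P D Z X Y p = 0

/-- `∇'` is a natural connection on `(M, P, g)`: a smooth linear connection with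
`∇' P = ∇' g = 0`. -/
structure IsNatural (g : Metric m M) (P : EndField m M) (D' : Conn m M) : Prop where
  smooth : D'.ContMDiffCovariantDerivative ∞
  parallel : ∀ X Y : VField m M, IsSmooth X → IsSmooth Y → ∀ p, D'.derEnd P X Y p = 0
  metric : IsMetricConn g D'

/-- The torsion as a tensor of type (0,3): `T(X, Y, Z) = g(T(X, Y), Z)`. -/
def tor3 (g : Metric m M) (D : Conn m M) (X Y Z : VField m M) (p : M) : ℝ :=
  g.app (D.tor X Y) Z p

/-- The curvature as a tensor of type (0,4): `R(X, Y, Z, W) = g(R(X, Y) Z, W)`. -/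
def curv4 (g : Metric m M) (D : Conn m M) (X Y Z W : VField m M) (p : M) : ℝ :=
  g.app (D.curv X Y Z) W p

/-- `∇'` is a canonical connection on `(M, P, g)`: a natural connection with
`T(X, Y, Z) + T(Y, Z, X) + T(PX, Y, PZ) + T(Y, PZ, PX) = 0`. -/
structure IsCanonical (g : Metric m M) (P : EndField m M) (D' : Conn m M) : Prop where
  natural : IsNatural g P D'
  torsion_eq : ∀ X Y Z : VField m M, IsSmooth X → IsSmooth Y → IsSmooth Z → ∀ p,
    tor3 g D' X Y Z p + tor3 g D' Y Z X p + tor3 g D' (P.app X) Y (P.app Z) p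
      + tor3 g D' Y (P.app Z) (P.app X) p = 0

end Metric

end

end AlmostProduct

/-! Write `∇' = ∇ + Q` and `Q_x = Q(x, ·)`. For torsion-free `∇`, comparing curvatures gives
`R'(x,y)z = R(x,y)z + (∇'_x Q)(y,z) - (∇'_y Q)(x,z) + Q(T(x,y),z) - [Q_x, Q_y]z` (`curv_eq`). Three
facts finish the proof. Both connections are metric, so each `Q_x` is skew-adjoint, and the
commutator yields the two products of `Q`-terms. The Koszul formula expresses `g(Q(x,y),z)` by `T`
with constant coefficients, so `∇'T = 0` and `∇'g = 0` force `∇'Q = 0` (`der_deformation`). Finally,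
the W₃ condition and the canonical torsion identity rewrite `g(Q(u,z),w)` as `g(Q(z,w),u) -
F(Pw,z,u)`; this is used at `u = T(x,y)`. -/

namespace AlmostProduct

/-- The algebraic core of the comparison of the two curvatures: if `q` is skew in its last two
arguments, the form `F(x, y, z) = q(x, y, Pz) - q(x, Py, z)` has vanishing cyclic sum and the
torsion `q(x, y, z) - q(y, x, z)` satisfies the canonical identity, then
`q(u, z, w) = q(z, w, u) - F(Pw, z, u)`. -/
theorem skew_eq_of_cyclic_of_canonical {V : Type*} (P : V → V) (hP : ∀ x, P (P x) = x)
    (q : V → V → V → ℝ) (skew : ∀ x y z, q x y z + q x z y = 0)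
    (cyclic : ∀ x y z, (q x y (P z) - q x (P y) z) + (q y z (P x) - q y (P z) x)
      + (q z x (P y) - q z (P x) y) = 0)
    (canonical : ∀ x y z, (q x y z - q y x z) + (q y z x - q z y x)
      + (q (P x) y (P z) - q y (P x) (P z)) + (q y (P z) (P x) - q (P z) y (P x)) = 0)
    (u z w : V) :
    q u z w = q z w u - (q (P w) z (P u) - q (P w) (P z) u) := by
  -- As `P² = 1`, these instances only involve `q` at permutations of `u, z, w` with `P` on none or
  -- exactly two of them. Additivity is never needed: the claim is linear algebra over these
  -- finitely many values.
  have c₁ := canonical (P u) (P z) w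
  have c₂ := canonical w z u
  have c₃ := canonical z (P u) (P w)
  have c₄ := canonical (P z) u (P w)
  have f₁ := cyclic (P u) (P z) (P w)
  have f₂ := cyclic u z (P w)
  simp only [hP] at c₁ c₂ c₃ c₄ f₁ f₂
  linear_combination (-1/8) * c₁ + (3/8) * c₂ + (-1/8) * c₃ + (-3/8) * c₄ + (-1/8) * f₁
    + (5/8) * f₂ + (3/8) * skew u z w + (5/8) * skew (P w) z (P u)
    + (-9/8) * skew (P w) (P z) u + (1/8) * skew (P u) (P z) w
    + (-1/8) * skew w (P z) (P u) + (3/8) * skew u (P z) (P w)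
    + (1/4) * skew (P z) (P w) u + (-3/8) * skew w z u + (-1/4) * skew z (P w) (P u)
    + (1/8) * skew (P u) z (P w)

variable {m : ℕ} {M : Type*} [TopologicalSpace M] [ChartedSpace (EuclideanSpace ℝ (Fin m)) M]
  [IsManifold (𝓡 m) ∞ M]

/-! ### Smoothness of the fields built from connections, brackets and torsion. -/

section Smoothness

theorem IsSmooth.mdifferentiableAt {X : VField m M} (hX : IsSmooth X) (p : M) :
    MDifferentiableAt (𝓡 m) (𝓡 m).tangent
      (fun p ↦ (⟨p, X p⟩ : TangentBundle (𝓡 m) M)) p :=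
  ContMDiff.mdifferentiableAt hX (by decide)

theorem IsSmooth.sub {X Y : VField m M} (hX : IsSmooth X) (hY : IsSmooth Y) :
    IsSmooth (X - Y) :=
  ContMDiff.sub_section hX hY

theorem IsSmooth.app {P : EndField m M} (hP : IsSmoothEnd P) {X : VField m M}
    (hX : IsSmooth X) : IsSmooth (P.app X) :=
  ContMDiff.clm_bundle_apply hP hX

theorem IsSmooth.mlieBracket {X Y : VField m M} (hX : IsSmooth X) (hY : IsSmooth Y) :
    IsSmooth (VectorField.mlieBracket (𝓡 m) X Y) := by
  have : IsManifold (𝓡 m) (minSmoothness ℝ 2) M := by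
    rw [minSmoothness_of_isRCLikeNormedField]
    infer_instance
  -- `∞ + 1` unfolds to `∞`, so the bracket costs no derivative.
  have : IsManifold (𝓡 m) (((⊤ : ℕ∞) : WithTop ℕ∞) + 1) M := ‹IsManifold (𝓡 m) ∞ M›
  exact ContDiff.mlieBracket_vectorField (m := ⊤) (n := ⊤) hX hY (by simp)

theorem IsSmooth.der {D : Conn m M} (hD : D.ContMDiffCovariantDerivative ∞) {X Y : VField m M}
    (hX : IsSmooth X) (hY : IsSmooth Y) : IsSmooth (D.der X Y) := by
  have h := hD.contMDiff.contMDiff (σ := Y) (by simpa using hY.contMDiffOn)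
  exact ContMDiff.clm_bundle_apply (contMDiffOn_univ.1 h) hX

theorem Conn.tor_eq (D : Conn m M) {X Y : VField m M} (hX : IsSmooth X) (hY : IsSmooth Y) :
    D.tor X Y = D.der X Y - D.der Y X - VectorField.mlieBracket (𝓡 m) X Y :=
  funext fun p ↦ D.torsion_apply (hX.mdifferentiableAt p) (hY.mdifferentiableAt p)

theorem IsSmooth.tor {D : Conn m M} (hD : D.ContMDiffCovariantDerivative ∞) {X Y : VField m M}
    (hX : IsSmooth X) (hY : IsSmooth Y) : IsSmooth (D.tor X Y) := by
  rw [D.tor_eq hX hY]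
  exact ((hX.der hD hY).sub (hY.der hD hX)).sub (hX.mlieBracket hY)

theorem IsSmooth.deformation {D D' : Conn m M} (hD : D.ContMDiffCovariantDerivative ∞)
    (hD' : D'.ContMDiffCovariantDerivative ∞) {X Y : VField m M}
    (hX : IsSmooth X) (hY : IsSmooth Y) : IsSmooth (deformation D D' X Y) :=
  (hX.der hD' hY).sub (hX.der hD hY)

theorem Metric.mdifferentiableAt_app (g : Metric m M) {X Y : VField m M} (hX : IsSmooth X)
    (hY : IsSmooth Y) (p : M) : MDifferentiableAt (𝓡 m) 𝓘(ℝ) (g.app X Y) p := by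
  have h : ContMDiff (𝓡 m) ((𝓡 m).prod 𝓘(ℝ)) ∞
      (fun p ↦ TotalSpace.mk' ℝ (E := Bundle.Trivial M ℝ) p (g.inner p (X p) (Y p))) :=
    ContMDiff.clm_bundle_apply₂ g.contMDiff hX hY
  have h' := fun p ↦ (contMDiffAt_totalSpace.1 (h p)).2
  exact (h' p).mdifferentiableAt (by simp)

end Smoothness

section Linearity

theorem Metric.app_symm (g : Metric m M) (X Y : VField m M) (p : M) :
    g.app X Y p = g.app Y X p :=
  g.symm p _ _

theorem Metric.app_add_left (g : Metric m M) (X Y Z : VField m M) (p : M) :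
    g.app (X + Y) Z p = g.app X Z p + g.app Y Z p := by
  simp [Metric.app]

theorem Metric.app_sub_left (g : Metric m M) (X Y Z : VField m M) (p : M) :
    g.app (X - Y) Z p = g.app X Z p - g.app Y Z p := by
  simp [Metric.app]

theorem Conn.der_add_right (D : Conn m M) (X : VField m M) {Y Z : VField m M} (hY : IsSmooth Y)
    (hZ : IsSmooth Z) : D.der X (Y + Z) = D.der X Y + D.der X Z :=
  funext fun p ↦ by
    simp [Conn.der, D.isCovariantDerivativeOnUniv.add (hY.mdifferentiableAt p)
      (hZ.mdifferentiableAt p)]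

theorem Conn.der_eq_sub_deformation (D D' : Conn m M) (X Y : VField m M) :
    D.der X Y = D'.der X Y - deformation D D' X Y :=
  funext fun p ↦ by simp [deformation]

theorem deformation_sub_left (D D' : Conn m M) (X Y Z : VField m M) :
    deformation D D' (X - Y) Z = deformation D D' X Z - deformation D D' Y Z :=
  funext fun p ↦ by
    simp only [deformation, Conn.der, Pi.sub_apply, map_sub]
    abel

end Linearity

/-! ### Comparison of two connections through `Q`. -/

section Comparison

variable {g : Metric m M} {D D' : Conn m M} {X Y Z W : VField m M}

/-- Both connections give the same Leibniz expansion of `X (g(Y, Z))`; subtract the two. -/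
theorem app_deformation_skew (hg : IsMetricConn g D) (hg' : IsMetricConn g D')
    (hX : IsSmooth X) (hY : IsSmooth Y) (hZ : IsSmooth Z) (p : M) :
    g.app (deformation D D' X Y) Z p + g.app (deformation D D' X Z) Y p = 0 := by
  have h := hg X Y Z hX hY hZ p
  have h' := hg' X Y Z hX hY hZ p
  have e (U V : VField m M) :
      g.app (deformation D D' X U) V p = g.app (D'.der X U) V p - g.app (D.der X U) V p :=
    g.app_sub_left (D'.der X U) (D.der X U) V p
  rw [e, e]
  rw [g.app_symm Y] at h h'
  linarith

theorem tor_eq_deformation_sub (hD : D.torsion = 0) (hX : IsSmooth X) (hY : IsSmooth Y) :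
    D'.tor X Y = deformation D D' X Y - deformation D D' Y X := by
  have h : D.tor X Y = 0 := funext fun p ↦ by simp [Conn.tor, hD]
  rw [D.tor_eq hX hY] at h
  rw [D'.tor_eq hX hY, ← sub_eq_zero.1 h]
  funext p
  simp only [deformation, Pi.sub_apply]
  abel

theorem tor3_eq_deformation_sub (hD : D.torsion = 0) (hX : IsSmooth X) (hY : IsSmooth Y)
    (Z : VField m M) (p : M) :
    tor3 g D' X Y Z p = g.app (deformation D D' X Y) Z p - g.app (deformation D D' Y X) Z p := by
  rw [tor3, tor_eq_deformation_sub hD hX hY, g.app_sub_left]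

/-- The Koszul formula for the deformation tensor of a metric connection. -/
theorem two_mul_app_deformation (hg : IsMetricConn g D) (hD : D.torsion = 0)
    (hg' : IsMetricConn g D') (hX : IsSmooth X) (hY : IsSmooth Y) (hZ : IsSmooth Z) (p : M) :
    2 * g.app (deformation D D' X Y) Z p =
      tor3 g D' X Y Z p - tor3 g D' Y Z X p + tor3 g D' Z X Y p := by
  rw [tor3_eq_deformation_sub hD hX hY, tor3_eq_deformation_sub hD hY hZ,
    tor3_eq_deformation_sub hD hZ hX]
  linarith [app_deformation_skew hg hg' hX hY hZ p, app_deformation_skew hg hg' hY hX hZ p,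
    app_deformation_skew hg hg' hZ hX hY p]

/-- If `∇' g = 0` and `∇' T = 0`, then `T` of type (0,3) satisfies the Leibniz rule. -/
theorem mvfderiv_tor3 (hs' : D'.ContMDiffCovariantDerivative ∞) (hg' : IsMetricConn g D')
    (hpar : D'.HasParallelTorsion) (hX : IsSmooth X) (hY : IsSmooth Y) (hZ : IsSmooth Z)
    (hW : IsSmooth W) (p : M) :
    mvfderiv (𝓡 m) (tor3 g D' Y Z W) p (X p) =
      tor3 g D' (D'.der X Y) Z W p + tor3 g D' Y (D'.der X Z) W p
        + tor3 g D' Y Z (D'.der X W) p := by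
  have h : D'.der X (D'.tor Y Z) = D'.tor (D'.der X Y) Z + D'.tor Y (D'.der X Z) :=
    funext fun q ↦ by
      have := hpar X Y Z hX hY hZ q
      rw [Conn.derTor, sub_sub, sub_eq_zero] at this
      exact this
  have := hg' X (D'.tor Y Z) W hX (hY.tor hs' hZ) hW p
  rw [h, g.app_add_left] at this
  exact this

/-- If the torsion of the metric connection `∇'` is parallel, so is the deformation tensor `Q`. -/
theorem der_deformation (hLC : IsLeviCivita g D) (hs' : D'.ContMDiffCovariantDerivative ∞)
    (hg' : IsMetricConn g D') (hpar : D'.HasParallelTorsion) (hX : IsSmooth X) (hY : IsSmooth Y)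
    (hZ : IsSmooth Z) (hW : IsSmooth W) (p : M) :
    g.app (D'.der X (deformation D D' Y Z)) W p =
      g.app (deformation D D' (D'.der X Y) Z) W p
        + g.app (deformation D D' Y (D'.der X Z)) W p := by
  have koszul {U V S : VField m M} (hU : IsSmooth U) (hV : IsSmooth V) (hS : IsSmooth S) (q : M) :=
    two_mul_app_deformation hLC.metric hLC.torsion_free hg' hU hV hS q
  have dT {U V S : VField m M} (hU : IsSmooth U) (hV : IsSmooth V) (hS : IsSmooth S) :
      MDifferentiableAt (𝓡 m) 𝓘(ℝ) (tor3 g D' U V S) p :=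
    g.mdifferentiableAt_app (hU.tor hs' hV) hS p
  have hQ := hY.deformation hLC.smooth hs' hZ
  have dQ := g.mdifferentiableAt_app hQ hW p
  -- The Koszul formula as an identity of functions, to be differentiated along `X`. The factor 2 is
  -- written as a sum so that additivity of the derivative suffices.
  have hfun : g.app (deformation D D' Y Z) W + g.app (deformation D D' Y Z) W =
      tor3 g D' Y Z W - tor3 g D' Z W Y + tor3 g D' W Y Z := funext fun q ↦ by
    simpa [two_mul] using koszul hY hZ hW q
  have hd := congrArg (fun f : M → ℝ ↦ mvfderiv (𝓡 m) f p (X p)) hfun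
  simp only [mvfderiv_add dQ dQ,
    mvfderiv_add ((dT hY hZ hW).sub (dT hZ hW hY)) (dT hW hY hZ),
    mvfderiv_sub (dT hY hZ hW) (dT hZ hW hY), add_apply,
    sub_apply, mvfderiv_tor3 hs' hg' hpar hX hY hZ hW,
    mvfderiv_tor3 hs' hg' hpar hX hZ hW hY, mvfderiv_tor3 hs' hg' hpar hX hW hY hZ,
    hg' X _ W hX hQ hW] at hd
  -- Koszul with one argument replaced by its `∇'_X`-derivative regroups the torsion terms; those
  -- containing `∇'_X W` cancel.
  linarith [koszul (hX.der hs' hY) hZ hW p, koszul hY (hX.der hs' hZ) hW p,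
    koszul hY hZ (hX.der hs' hW) p]

/-- The curvatures of two connections, compared in terms of the
deformation tensor and its derivatives along the second connection. -/
theorem curv_eq (hs : D.ContMDiffCovariantDerivative ∞) (hs' : D'.ContMDiffCovariantDerivative ∞)
    (hX : IsSmooth X) (hY : IsSmooth Y) (hZ : IsSmooth Z) :
    D'.curv X Y Z = D.curv X Y Z
      + (D'.der X (deformation D D' Y Z)
        - (deformation D D' (D'.der X Y) Z + deformation D D' Y (D'.der X Z)))
      - (D'.der Y (deformation D D' X Z)
        - (deformation D D' (D'.der Y X) Z + deformation D D' X (D'.der Y Z)))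
      + deformation D D' (D'.tor X Y) Z
      - (deformation D D' X (deformation D D' Y Z)
        - deformation D D' Y (deformation D D' X Z)) := by
  -- Substitute `∇' = ∇ + Q` in the inner derivative, then trade the outer `∇` for `∇' - Q`. Keeping
  -- `∇'` on `Q` prepares for `∇'Q = 0` and accounts for the minus sign at the commutator.
  have expand {U V : VField m M} (hV : IsSmooth V) :
      D'.der U (D'.der V Z) = D.der U (D.der V Z) + D'.der U (deformation D D' V Z)
        + deformation D D' U (D'.der V Z) - deformation D D' U (deformation D D' V Z) := by
    have h₁ := D.der_add_right U (hV.der hs hZ) (hV.deformation hs hs' hZ)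
    have h₂ : D.der V Z + deformation D D' V Z = D'.der V Z := by
      rw [D.der_eq_sub_deformation D', sub_add_cancel]
    rw [h₂] at h₁
    rw [D.der_eq_sub_deformation D' U (D'.der V Z),
      D.der_eq_sub_deformation D' U (deformation D D' V Z)] at h₁
    rw [sub_eq_iff_eq_add.1 h₁]
    abel
  rw [D'.tor_eq hX hY, deformation_sub_left, deformation_sub_left]
  have hb := D.der_eq_sub_deformation D' (VectorField.mlieBracket (𝓡 m) X Y) Z
  have hXY := expand (U := X) hY
  have hYX := expand (U := Y) hX
  have e' : D'.curv X Y Z = D'.der X (D'.der Y Z) - D'.der Y (D'.der X Z)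
    - D'.der (VectorField.mlieBracket (𝓡 m) X Y) Z := rfl
  have e : D.curv X Y Z = D.der X (D.der Y Z) - D.der Y (D.der X Z)
    - D.der (VectorField.mlieBracket (𝓡 m) X Y) Z := rfl
  rw [e, e', hXY, hYX, hb]
  abel

end Comparison

/-! ### The almost product structure and the W₃ condition. -/

section AlmostProductStructure

variable {g : Metric m M} {P : EndField m M} {D D' : Conn m M} {X Y Z W : VField m M}

theorem IsAlmostProduct.app_app (h : IsAlmostProduct g P) (X : VField m M) :
    P.app (P.app X) = X :=
  funext fun p ↦ h.sq p (X p)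

theorem IsAlmostProduct.app_symm (h : IsAlmostProduct g P) (X Y : VField m M) (p : M) :
    g.app (P.app X) Y p = g.app X (P.app Y) p := by
  have := h.isometry p (X p) (P p (Y p))
  rwa [h.sq] at this

/-- `F(X, Y, Z) = Q(X, Y, PZ) - Q(X, PY, Z)` if `∇' P = 0`. -/
theorem F_eq (h : IsAlmostProduct g P) (hn : IsNatural g P D') (hX : IsSmooth X)
    (hY : IsSmooth Y) (Z : VField m M) (p : M) :
    F g P D X Y Z p =
      g.app (deformation D D' X Y) (P.app Z) p - g.app (deformation D D' X (P.app Y)) Z p := by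
  have e : D.derEnd P X Y = P.app (deformation D D' X Y) - deformation D D' X (P.app Y) :=
    funext fun q ↦ by
      have hq := hn.parallel X Y hX hY q
      simp only [Conn.derEnd, sub_eq_zero] at hq
      simp only [Conn.derEnd, deformation, EndField.app, Pi.sub_apply, map_sub] at hq ⊢
      rw [← hq]
      abel
  rw [F, e, g.app_sub_left, h.app_symm]

/-- `Q(X, Z, W) = Q(Z, W, X) - F(PW, Z, X)` for the canonical connection of a `W₃`-manifold. -/
theorem IsCanonical.app_deformation_eq (hcan : IsCanonical g P D') (hW3 : IsW3 g P D)
    (hX : IsSmooth X) (hZ : IsSmooth Z) (hW : IsSmooth W) (p : M) :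
    g.app (deformation D D' X Z) W p =
      g.app (deformation D D' Z W) X p - F g P D (P.app W) Z X p := by
  obtain ⟨hP, hLC, hcyc⟩ := hW3
  obtain ⟨hn, htor⟩ := hcan
  have hPs {U : VField m M} (hU : IsSmooth U) : IsSmooth (P.app U) := hU.app hP.smooth
  rw [F_eq hP hn (hPs hW) hZ]
  -- The hypotheses are known only for smooth fields, so the algebraic lemma is applied to the type
  -- of smooth fields, on which `P` acts as an involution.
  refine skew_eq_of_cyclic_of_canonical (V := {U : VField m M // IsSmooth U})
    (fun U ↦ ⟨P.app U.1, hPs U.2⟩) (fun U ↦ Subtype.ext (hP.app_app U.1))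
    (fun U V S ↦ g.app (deformation D D' U.1 V.1) S.1 p) ?_ ?_ ?_ ⟨X, hX⟩ ⟨Z, hZ⟩ ⟨W, hW⟩
  · exact fun U V S ↦ app_deformation_skew hLC.metric hn.metric U.2 V.2 S.2 p
  · intro U V S
    have := hcyc U.1 V.1 S.1 U.2 V.2 S.2 p
    rwa [F_eq hP hn U.2 V.2, F_eq hP hn V.2 S.2, F_eq hP hn S.2 U.2] at this
  · intro U V S
    have := htor U.1 V.1 S.1 U.2 V.2 S.2 p
    rwa [tor3_eq_deformation_sub hLC.torsion_free U.2 V.2,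
      tor3_eq_deformation_sub hLC.torsion_free V.2 S.2,
      tor3_eq_deformation_sub hLC.torsion_free (hPs U.2) V.2,
      tor3_eq_deformation_sub hLC.torsion_free V.2 (hPs S.2)] at this

end AlmostProductStructure

end AlmostProduct

theorem theorem6p3 {m : ℕ} {M : Type*} [TopologicalSpace M] [T2Space M]
    [ChartedSpace (EuclideanSpace ℝ (Fin m)) M] [IsManifold (𝓡 m) ∞ M]
    (g : AlmostProduct.Metric m M) (P : AlmostProduct.EndField m M)
    (D D' : AlmostProduct.Conn m M)
    (hW3 : AlmostProduct.IsW3 g P D)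
    (hcan : AlmostProduct.IsCanonical g P D')
    (hpar : D'.HasParallelTorsion)
    (X Y Z W : AlmostProduct.VField m M)
    (hX : AlmostProduct.IsSmooth X) (hY : AlmostProduct.IsSmooth Y)
    (hZ : AlmostProduct.IsSmooth Z) (hW : AlmostProduct.IsSmooth W) (p : M) :
    AlmostProduct.curv4 g D' X Y Z W p =
      AlmostProduct.curv4 g D X Y Z W p
      + g.app (AlmostProduct.deformation D D' Y Z) (AlmostProduct.deformation D D' X W) p
      - g.app (AlmostProduct.deformation D D' X Z) (AlmostProduct.deformation D D' Y W) p
      + g.app (AlmostProduct.deformation D D' Z W) (D'.tor X Y) p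
      - g.app (D.derEnd P (P.app W) Z) (D'.tor X Y) p := by
  have hLC := hW3.leviCivita
  have hs := hLC.smooth
  have hs' := hcan.natural.smooth
  have hg' := hcan.natural.metric
  have hYZ := hY.deformation hs hs' hZ
  have hXZ := hX.deformation hs hs' hZ
  have hT := hcan.app_deformation_eq hW3 (hX.tor hs' hY) hZ hW p
  have dXY := AlmostProduct.der_deformation hLC hs' hg' hpar hX hY hZ hW p
  have dYX := AlmostProduct.der_deformation hLC hs' hg' hpar hY hX hZ hW p
  -- Skewness of `Q_X` turns `-g(Q(X, Q(Y,Z)), W)` into `g(Q(Y,Z), Q(X,W))`, and likewise with `X`,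
  -- `Y` exchanged.
  have sXY := AlmostProduct.app_deformation_skew hLC.metric hg' hX hYZ hW p
  have sYX := AlmostProduct.app_deformation_skew hLC.metric hg' hY hXZ hW p
  rw [g.app_symm _ (AlmostProduct.deformation D D' Y Z)] at sXY
  rw [g.app_symm _ (AlmostProduct.deformation D D' X Z)] at sYX
  rw [AlmostProduct.F] at hT
  simp only [AlmostProduct.curv4, AlmostProduct.curv_eq hs hs' hX hY hZ,
    AlmostProduct.Metric.app_add_left, AlmostProduct.Metric.app_sub_left]
  linarith
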